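/- Let $\mathbb{D}=\{z\in\mathbb{C}:|z|<1\}$ and, for $\mu,\nu\in\mathbb{R}$, let $$\psi_{\mu,\nu}(z)=\frac{1}{1-2ze^{i\mu}\cos\nu+z^2e^{2i\mu}},\qquad z\in\mathbb{D}.$$ A domain $\Omega\subseteq\mathbb{C}$ is called convex in the direction $\gamma\in\mathbb{R}$ if every line parallel to the line joining $0$ to $e^{i\gamma}$ has connected (possibly empty) intersection with $\Omega$; a mapping $f$ on $\mathbb{D}$ is called convex in the direction $\gamma$ if $f(\mathbb{D})$ is a domain convex in the direction $\gamma$. Theorem. Let $\mu,\nu\in\mathbb{R}$, and let $p$ be analytic in $\mathbb{D}$ with $\operatorname{Re}p(z)>0$ for $z\in\mathbb{D}$. For $k=1,2$ let $h_k,g_k$ be analytic in $\mathbb{D}$ such that the harmonic mapping $f_k=h_k+\overline{g_k}$ is locally univalent and sense-preserving (positive Jacobian) in $\mathbb{D}$ and $$h_k(z)-e^{-2i\mu}g_k(z)=\int_0^z\psi_{\mu,\nu}(\xi)\,p(\xi)\,d\xi,\qquad z\in\mathbb{D}.$$ For $\eta\in\mathbb{C}$ put $$f=\eta h_1+(1-\eta)h_2+\overline{\eta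 g_1+(1-\eta)g_2}.$$ Then: 1. For every real $\eta$ with $0\le\eta\le1$, the mapping $f$ is univalent in $\mathbb{D}$ and convex in the direction $-\mu$. 2. If $\alpha_1,\alpha_2\le1$ are real numbers such that the dilatation $\omega_k=g_k'/h_k'$ of $f_k$ satisfies $|\omega_k(z)|<\alpha_k$ for all $z\in\mathbb{D}$ and $k=1,2$ (so that $\alpha_k>0$), then for every $\eta\in\mathbb{C}$ with $$|\eta|\le\frac{(1-\alpha_1)(1-\alpha_2)}{2(\alpha_1+\alpha_2)}$$ the mapping $f$ is univalent in $\mathbb{D}$ and convex in the direction $-\mu$. -/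

import Mathlib

open Complex Set Metric Topology
open scoped ComplexConjugate

namespace PlanarHarmonic

noncomputable section

/-- The open unit disk. -/
abbrev unitDisk : Set ℂ := ball (0 : ℂ) 1

/-- The mapping `h + conj g` with analytic part `h` and co-analytic part `g`. -/
def harmonicMap (h g : ℂ → ℂ) (z : ℂ) : ℂ := h z + conj (g z)

/-- The dilatation `ω = g' / h'` of the mapping `h + conj g`. -/
def dilatation (h g : ℂ → ℂ) (z : ℂ) : ℂ := deriv g z / deriv h z

/-- `f` is injective near every point of `U`. -/
def LocallyUnivalentOn (f : ℂ → ℂ) (U : Set ℂ) : Prop :=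
  ∀ z ∈ U, ∃ V ∈ 𝓝 z, InjOn f V

/-- The real Jacobian determinant of `f` is positive at every point of `U`. -/
def SensePreservingOn (f : ℂ → ℂ) (U : Set ℂ) : Prop :=
  ∀ z ∈ U, 0 < (fderiv ℝ f z).det

/-- The line through `w` parallel to the line joining `0` to `exp (i γ)`. -/
def lineInDirection (γ : ℝ) (w : ℂ) : Set ℂ :=
  {v | ∃ t : ℝ, v = w + t * exp (γ * I)}

/-- `Ω` is a domain, and every line in the direction `γ` meets it in a connected
(possibly empty) set. -/
def IsDomainConvexInDirection (γ : ℝ) (Ω : Set ℂ) : Prop :=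
  IsOpen Ω ∧ IsConnected Ω ∧ ∀ w : ℂ, IsPreconnected (Ω ∩ lineInDirection γ w)

/-- `f` is univalent on the unit disk and maps it onto a domain convex in the direction `γ`. -/
def UnivalentConvexInDirection (γ : ℝ) (f : ℂ → ℂ) : Prop :=
  InjOn f unitDisk ∧ IsDomainConvexInDirection γ (f '' unitDisk)

/-- `ψ_{μ,ν}(z) = (1 - 2 z e^{iμ} cos ν + z² e^{2iμ})⁻¹`; the bracket has no zero
in the unit disk. -/
def psi (μ ν : ℝ) (z : ℂ) : ℂ :=
  (1 - 2 * z * exp (μ * I) * (Real.cos ν : ℂ) + z ^ 2 * exp (2 * μ * I))⁻¹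

/-- The integral `∫₀ᶻ F(ξ) dξ` along the segment from `0` to `z`. -/
def integralFromZero (F : ℂ → ℂ) (z : ℂ) : ℂ :=
  ∫ t in (0 : ℝ)..1, F (t * z) * z

/-- The combination `η h₁ + (1 - η) h₂ + conj (η g₁ + (1 - η) g₂)`, with the same `η` in both
parts. -/
def combination (η : ℂ) (h₁ g₁ h₂ g₂ : ℂ → ℂ) : ℂ → ℂ :=
  harmonicMap (fun z => η * h₁ z + (1 - η) * h₂ z) (fun z => η * g₁ z + (1 - η) * g₂ z)

end

end PlanarHarmonic

open PlanarHarmonic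

/-! This is the shear construction carried out in a coordinate that removes `psi`. The kernel has a
primitive whose inverse `w` maps a vertical strip or half-plane onto the disk and satisfies `w' = 1
- 2 w cos ν + w²` (`exists_strip_map`). Composing with `w` and rotating by `μ` turns lines of
direction `-μ` into horizontal lines, and turns the mapping into `H + conj G` with `H' - G'` equal
to `p` in the new variable, so that `Re (H' - G') > 0`.

The imaginary part of `H + conj G` is that of `Φ = H - G`. Since `Re Φ' > 0`, `Im Φ` increases
strictly along verticals, so each level set is a graph over a set of abscissas. A maximum principle
shows that this set is an interval (`ordConnected_levelSet_re`). Along the graph the positive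
Jacobian makes the real part of `H + conj G` strictly increasing. This gives injectivity on every
level set, and its image is connected (`injOn_and_isPreconnected_of_strip`).

A combination with parameter `η` satisfies the same shear equation for every complex `η`, so only
its Jacobian has to be checked. For `0 ≤ η ≤ 1` positivity is an affine condition on `g'` once `h' -
κ g'` is fixed; for small complex `η` it follows from a norm estimate
(`jacobian_pos_complex_combination`). -/

/-! ### Level sets of `Im Φ` when `Re Φ' > 0` on a strip -/

/-- A Phragmén–Lindelöf argument. On the half-strip above height `y₀`, monotonicity gives `Im Φ ≥
c'` on both sides and a lower bound `c' - B` everywhere. The deficit `B` on the bottom edge is felt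
only up to an exponentially decaying error higher up. -/
theorem exists_lt_im_of_monotone_of_le {Φ : ℂ → ℂ} {x₁ x₃ y₀ c c' x : ℝ}
    (hΦ : ∀ z : ℂ, z.re ∈ Icc x₁ x₃ → DifferentiableAt ℂ Φ z)
    (hmono : ∀ x ∈ Icc x₁ x₃, Monotone fun y : ℝ => (Φ ⟨x, y⟩).im)
    (h₁ : c' ≤ (Φ ⟨x₁, y₀⟩).im) (h₃ : c' ≤ (Φ ⟨x₃, y₀⟩).im) (hc : c < c')
    (hx : x ∈ Ioo x₁ x₃) : ∃ y : ℝ, c < (Φ ⟨x, y⟩).im := by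
  have h13 : x₁ < x₃ := hx.1.trans hx.2
  have hline : ContinuousOn (fun x : ℝ => (Φ ⟨x, y₀⟩).im) (Icc x₁ x₃) := by
    intro s hs
    have hmk : Continuous fun x : ℝ => (⟨x, y₀⟩ : ℂ) := by
      have : (fun x : ℝ => (⟨x, y₀⟩ : ℂ)) = fun x : ℝ => (x : ℂ) + y₀ * I := by
        ext x; exact Complex.mk_eq_add_mul_I x y₀
      rw [this]; fun_prop
    have h : ContinuousAt (fun x : ℝ => Φ ⟨x, y₀⟩) s :=
      ContinuousAt.comp (f := fun x : ℝ => (⟨x, y₀⟩ : ℂ)) (hΦ ⟨s, y₀⟩ hs).continuousAt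
        hmk.continuousAt
    exact (continuous_im.continuousAt.comp h).continuousWithinAt
  obtain ⟨m₀, hm₀⟩ := (isCompact_Icc.image_of_continuousOn hline).bddBelow
  obtain ⟨B, hB0, hB⟩ : ∃ B : ℝ, 0 < B ∧ ∀ s ∈ Icc x₁ x₃, c' - B ≤ (Φ ⟨s, y₀⟩).im := by
    refine ⟨max 1 (c' - m₀), lt_max_of_lt_left one_pos, fun s hs => ?_⟩
    have := hm₀ (mem_image_of_mem _ hs)
    have h2 := le_max_right 1 (c' - m₀)
    linarith
  -- This frequency keeps the argument `l * (s - m)` small across the strip, so the cosine stays at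
  -- least `1 / 2` and `2 * B * cos` covers the deficit `B`.
  set l : ℝ := 1 / (x₃ - x₁) with hl
  have hl0 : 0 < l := by rw [hl]; exact one_div_pos.2 (by linarith)
  set m : ℝ := (x₁ + x₃) / 2 with hm
  have hcos : ∀ s ∈ Icc x₁ x₃, 1 / 2 ≤ Real.cos (l * (s - m)) := by
    intro s hs
    have h1 : l * (x₃ - x₁) = 1 := by rw [hl]; field_simp; exact div_self (by linarith)
    have hsq : (l * (s - m)) ^ 2 ≤ 1 := by
      rw [sq_le_one_iff_abs_le_one, abs_le]
      constructor <;> nlinarith [hs.1, hs.2]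
    have := Real.one_sub_sq_div_two_le_cos (x := l * (s - m))
    linarith
  have hlim : Filter.Tendsto (fun t : ℝ => 2 * B * Real.exp (-(l * t))) Filter.atTop (𝓝 0) := by
    have h := (Real.tendsto_exp_neg_atTop_nhds_zero.comp
      (Filter.tendsto_id.const_mul_atTop hl0)).const_mul (2 * B)
    simpa [Function.comp_def] using h
  obtain ⟨t, htlt, ht0⟩ := ((hlim.eventually (gt_mem_nhds (show 0 < (c' - c) / 2 by linarith))).and
    (Filter.eventually_gt_atTop 0)).exists
  set ε : ℝ := (c' - c) / (2 * t) with hε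
  have hε0 : 0 < ε := by rw [hε]; exact div_pos (by linarith) (by linarith)
  have hεt : ε * t = (c' - c) / 2 := by rw [hε]; field_simp
  set Y : ℝ := y₀ + t + B / ε with hY
  have hBε : ε * (B / ε) = B := by field_simp
  have hBε0 : 0 < B / ε := by positivity
  -- `Im Ψ ≥ 0` on the boundary of the rectangle: the exponential term pays for the bottom edge, and
  -- the linear term for the top, which is why `Y` contains `B / ε`. The maximum principle for `exp
  -- (I * Ψ)`, of norm `exp (-Im Ψ)`, carries this to the point at height `y₀ + t`, where the two
  -- corrections together are less than `c' - c`.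
  let Ψ : ℂ → ℂ := fun z => Φ z + ε * (z - y₀ * I)
    + 2 * B * I * exp (I * (l * (z - m - y₀ * I))) - c' * I
  have hΨim : ∀ a b : ℝ, (Ψ ⟨a, b⟩).im = (Φ ⟨a, b⟩).im + ε * (b - y₀)
      + 2 * B * (Real.exp (-(l * (b - y₀))) * Real.cos (l * (a - m))) - c' := by
    intro a b
    have he : (exp (I * (l * ((⟨a, b⟩ : ℂ) - m - y₀ * I)))).re
        = Real.exp (-(l * (b - y₀))) * Real.cos (l * (a - m)) := by
      rw [exp_re]; simp
    have h2 : ∀ w : ℂ, (2 * (B : ℂ) * I * w).im = 2 * B * w.re := by intro w; simp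
    simp only [Ψ, sub_im, add_im, h2, he]
    simp
  have hU : Bornology.IsBounded (Ioo x₁ x₃ ×ℂ Ioo y₀ Y) :=
    (isBounded_Ioo _ _).reProdIm (isBounded_Ioo _ _)
  have hyY : y₀ < Y := by linarith
  have hcl : closure (Ioo x₁ x₃ ×ℂ Ioo y₀ Y) = Icc x₁ x₃ ×ℂ Icc y₀ Y := by
    rw [closure_reProdIm, closure_Ioo h13.ne, closure_Ioo hyY.ne]
  have hd : DiffContOnCl ℂ (fun z => exp (I * Ψ z)) (Ioo x₁ x₃ ×ℂ Ioo y₀ Y) := by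
    apply DifferentiableOn.diffContOnCl
    rw [hcl]
    intro z hz
    have := hΦ z hz.1
    apply DifferentiableAt.differentiableWithinAt
    fun_prop
  have hfr : ∀ z ∈ frontier (Ioo x₁ x₃ ×ℂ Ioo y₀ Y), ‖exp (I * Ψ z)‖ ≤ 1 := by
    rintro ⟨a, b⟩ hz
    rw [norm_exp, Real.exp_le_one_iff]
    have hre : (I * Ψ ⟨a, b⟩).re = -(Ψ ⟨a, b⟩).im := by simp
    rw [hre, neg_nonpos, hΨim]
    rw [frontier_reProdIm, closure_Ioo h13.ne, closure_Ioo hyY.ne, frontier_Ioo h13,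
      frontier_Ioo hyY] at hz
    have key : ∀ a ∈ Icc x₁ x₃, 0 ≤ 2 * B * (Real.exp (-(l * (b - y₀))) * Real.cos (l * (a - m))) :=
      fun a ha => by have := hcos a ha; positivity
    have hb0 : ∀ a ∈ Icc x₁ x₃, y₀ ≤ b → (Φ ⟨a, y₀⟩).im ≤ (Φ ⟨a, b⟩).im :=
      fun a ha h => hmono a ha h
    rcases hz with ⟨ha, hb⟩ | ⟨ha, hb⟩
    · simp only [mem_preimage] at ha hb
      have hk := key a ha
      rcases hb with rfl | hb
      · have := hcos a ha
        have := hB a ha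
        simp only [sub_self, mul_zero, neg_zero, Real.exp_zero, one_mul, add_zero]
        nlinarith
      · rw [mem_singleton_iff] at hb
        subst hb
        have := hb0 a ha hyY.le
        have := hB a ha
        have : ε * (Y - y₀) = ε * t + B := by rw [hY]; linear_combination hBε
        have : 0 < ε * t := by positivity
        linarith
    · simp only [mem_preimage] at ha hb
      have hε2 : 0 ≤ ε * (b - y₀) := mul_nonneg hε0.le (by linarith [hb.1])
      rcases ha with rfl | ha
      · have hk := key a ⟨le_rfl, h13.le⟩
        have := hb0 a ⟨le_rfl, h13.le⟩ hb.1
        linarith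
      · rw [mem_singleton_iff] at ha
        subst ha
        have hk := key a ⟨h13.le, le_rfl⟩
        have := hb0 a ⟨h13.le, le_rfl⟩ hb.1
        linarith
  have hmain := norm_le_of_forall_mem_frontier_norm_le hU hd hfr (z := ⟨x, y₀ + t⟩)
    (by rw [hcl]; exact ⟨⟨hx.1.le, hx.2.le⟩, ⟨by simp [ht0.le], by simp; linarith⟩⟩)
  rw [norm_exp, Real.exp_le_one_iff] at hmain
  have hre : (I * Ψ ⟨x, y₀ + t⟩).re = -(Ψ ⟨x, y₀ + t⟩).im := by simp
  rw [hre, neg_nonpos, hΨim, add_sub_cancel_left] at hmain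
  refine ⟨y₀ + t, ?_⟩
  have : 2 * B * (Real.exp (-(l * t)) * Real.cos (l * (x - m))) ≤ 2 * B * Real.exp (-(l * t)) := by
    have h1 := Real.cos_le_one (l * (x - m))
    have h2 : Real.exp (-(l * t)) * Real.cos (l * (x - m)) ≤ Real.exp (-(l * t)) :=
      mul_le_of_le_one_right (Real.exp_pos _).le h1
    nlinarith
  linarith

theorem hasDerivAt_im_vertical {Φ : ℂ → ℂ} {d : ℂ} {x y : ℝ} (h : HasDerivAt Φ d ⟨x, y⟩) :
    HasDerivAt (fun y : ℝ => (Φ ⟨x, y⟩).im) d.re y := by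
  have hmk : HasDerivAt (fun y : ℝ => (⟨x, y⟩ : ℂ)) I y := by
    have : (fun y : ℝ => (⟨x, y⟩ : ℂ)) = fun y : ℝ => (x : ℂ) + y * I := by
      ext y; exact Complex.mk_eq_add_mul_I x y
    rw [this]
    simpa using ((hasDerivAt_id y).ofReal_comp.mul_const I).const_add (x : ℂ)
  have h2 := HasDerivAt.scomp (h := fun y : ℝ => (⟨x, y⟩ : ℂ)) y h hmk
  have h3 := (imCLM.hasFDerivAt).comp_hasDerivAt y h2
  simpa [Function.comp_def] using h3

theorem strictMono_im_vertical {Φ : ℂ → ℂ} {x : ℝ}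
    (hΦ : ∀ y : ℝ, DifferentiableAt ℂ Φ ⟨x, y⟩) (hpos : ∀ y : ℝ, 0 < (deriv Φ ⟨x, y⟩).re) :
    StrictMono fun y : ℝ => (Φ ⟨x, y⟩).im := by
  refine strictMono_of_deriv_pos fun y => ?_
  rw [(hasDerivAt_im_vertical (hΦ y).hasDerivAt).deriv]
  exact hpos y

theorem exists_im_vertical_gt {Φ : ℂ → ℂ} {x₁ x₃ c y₁ y₃ x : ℝ}
    (hΦ : ∀ z : ℂ, z.re ∈ Icc x₁ x₃ → DifferentiableAt ℂ Φ z)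
    (hpos : ∀ z : ℂ, z.re ∈ Icc x₁ x₃ → 0 < (deriv Φ z).re)
    (h₁ : (Φ ⟨x₁, y₁⟩).im = c) (h₃ : (Φ ⟨x₃, y₃⟩).im = c) (hx : x ∈ Ioo x₁ x₃) :
    ∃ y : ℝ, c < (Φ ⟨x, y⟩).im := by
  have hmono : ∀ x ∈ Icc x₁ x₃, StrictMono fun y : ℝ => (Φ ⟨x, y⟩).im := fun x hx =>
    strictMono_im_vertical (fun y => hΦ _ hx) (fun y => hpos _ hx)
  have h13 : x₁ ≤ x₃ := (hx.1.trans hx.2).le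
  have a₁ : c < (Φ ⟨x₁, max y₁ y₃ + 1⟩).im := h₁ ▸ hmono x₁ ⟨le_rfl, h13⟩
    (show y₁ < max y₁ y₃ + 1 by linarith [le_max_left y₁ y₃])
  have a₃ : c < (Φ ⟨x₃, max y₁ y₃ + 1⟩).im := h₃ ▸ hmono x₃ ⟨h13, le_rfl⟩
    (show y₃ < max y₁ y₃ + 1 by linarith [le_max_right y₁ y₃])
  exact exists_lt_im_of_monotone_of_le hΦ (fun x hx => (hmono x hx).monotone)
    (min_le_left _ _) (min_le_right _ _) (lt_min a₁ a₃) hx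

/-- If `Re Φ' > 0` on a vertical strip, every level set of `Im Φ` projects onto an interval of the
real axis. -/
theorem ordConnected_levelSet_re {Φ : ℂ → ℂ} {J : Set ℝ} (hJ : J.OrdConnected)
    (hΦ : ∀ z : ℂ, z.re ∈ J → DifferentiableAt ℂ Φ z)
    (hpos : ∀ z : ℂ, z.re ∈ J → 0 < (deriv Φ z).re) (c : ℝ) :
    {x : ℝ | x ∈ J ∧ ∃ y : ℝ, (Φ ⟨x, y⟩).im = c}.OrdConnected := by
  refine ⟨?_⟩
  rintro x₁ ⟨hx₁, y₁, h₁⟩ x₃ ⟨hx₃, y₃, h₃⟩ x hx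
  have hxJ : x ∈ J := hJ.out hx₁ hx₃ hx
  refine ⟨hxJ, ?_⟩
  rcases eq_or_lt_of_le hx.1 with rfl | hlt₁
  · exact ⟨y₁, h₁⟩
  rcases eq_or_lt_of_le hx.2 with rfl | hlt₃
  · exact ⟨y₃, h₃⟩
  have hsub : Icc x₁ x₃ ⊆ J := hJ.out hx₁ hx₃
  obtain ⟨b, hb⟩ := exists_im_vertical_gt (fun z hz => hΦ z (hsub hz))
    (fun z hz => hpos z (hsub hz)) h₁ h₃ ⟨hlt₁, hlt₃⟩
  -- The half-turn `z ↦ -Φ (-z)` preserves the hypothesis on the derivative and exchanges up and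
  -- down, so it yields a value below `c`; the intermediate value theorem then finishes.
  have hneg : ∀ z : ℂ, z.re ∈ Icc (-x₃) (-x₁) →
      HasDerivAt (fun z => -Φ (-z)) (deriv Φ (-z)) z := by
    intro z hz
    have h := (hΦ (-z) (hsub (by simp only [neg_re]; constructor <;> linarith [hz.1, hz.2]))).hasDerivAt
    simpa using! (h.scomp z (hasDerivAt_neg z)).neg
  have hnmk : ∀ a b : ℝ, -(⟨-a, b⟩ : ℂ) = ⟨a, -b⟩ := fun a b => by apply Complex.ext <;> simp
  obtain ⟨a, ha⟩ := exists_im_vertical_gt (Φ := fun z => -Φ (-z)) (x₁ := -x₃) (x₃ := -x₁)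
    (c := -c) (y₁ := -y₃) (y₃ := -y₁) (x := -x)
    (fun z hz => (hneg z hz).differentiableAt)
    (fun z hz => by
      rw [(hneg z hz).deriv]
      exact hpos _ (hsub (by simp only [neg_re]; constructor <;> linarith [hz.1, hz.2])))
    (by simp only [hnmk, neg_neg, neg_im, h₃]) (by simp only [hnmk, neg_neg, neg_im, h₁])
    ⟨by linarith, by linarith⟩
  simp only [hnmk, neg_im, neg_lt_neg_iff] at ha
  have hcont : Continuous fun y : ℝ => (Φ ⟨x, y⟩).im :=
    continuous_iff_continuousAt.2 fun y =>
      (hasDerivAt_im_vertical (hΦ ⟨x, y⟩ hxJ).hasDerivAt).continuousAt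
  exact mem_range_of_exists_le_of_exists_ge hcont ⟨_, ha.le⟩ ⟨_, hb.le⟩

/-! ### Differentials and Jacobians of harmonic mappings -/

/-- The real differential `v ↦ a v + conj (b v)` of a harmonic mapping `h + conj g` with `h' = a`
and `g' = b`. -/
noncomputable def harmonicDifferential (a b : ℂ) : ℂ →L[ℝ] ℂ :=
  (ContinuousLinearMap.toSpanSingleton ℂ a).restrictScalars ℝ +
    (conjCLE : ℂ →L[ℝ] ℂ).comp ((ContinuousLinearMap.toSpanSingleton ℂ b).restrictScalars ℝ)

theorem harmonicDifferential_apply (a b v : ℂ) :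
    harmonicDifferential a b v = v * a + conj (v * b) := by
  simp [harmonicDifferential]

theorem det_harmonicDifferential (a b : ℂ) :
    (harmonicDifferential a b).det = normSq a - normSq b := by
  rw [ContinuousLinearMap.det, ← LinearMap.det_toMatrix Complex.basisOneI, Matrix.det_fin_two]
  simp only [LinearMap.toMatrix_apply, ContinuousLinearMap.coe_coe, harmonicDifferential_apply]
  simp [normSq_apply]
  ring

theorem HasStrictDerivAt.harmonicMap {h g : ℂ → ℂ} {a b z : ℂ} (hh : HasStrictDerivAt h a z)
    (hg : HasStrictDerivAt g b z) :
    HasStrictFDerivAt (harmonicMap h g) (harmonicDifferential a b) z := by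
  have h1 := hh.hasStrictFDerivAt.restrictScalars ℝ
  have h2 := (conjCLE : ℂ →L[ℝ] ℂ).hasStrictFDerivAt.comp z (hg.hasStrictFDerivAt.restrictScalars ℝ)
  exact h1.add h2

theorem DifferentiableOn.hasStrictDerivAt {h : ℂ → ℂ} {U : Set ℂ} (hh : DifferentiableOn ℂ h U)
    (hU : IsOpen U) {z : ℂ} (hz : z ∈ U) : HasStrictDerivAt h (_root_.deriv h z) z :=
  (hh.analyticAt (hU.mem_nhds hz)).hasStrictDerivAt

/-- The harmonic differential as a linear equivalence, when its determinant does not vanish. -/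
noncomputable def harmonicDifferentialEquiv (a b : ℂ) (h : normSq b < normSq a) : ℂ ≃L[ℝ] ℂ :=
  (harmonicDifferential a b).toContinuousLinearEquivOfDetNeZero
    (by rw [det_harmonicDifferential]; exact (sub_pos.2 h).ne')

theorem coe_harmonicDifferentialEquiv (a b : ℂ) (h : normSq b < normSq a) :
    (harmonicDifferentialEquiv a b h : ℂ →L[ℝ] ℂ) = harmonicDifferential a b := by
  simp [harmonicDifferentialEquiv]

theorem isOpen_image_harmonicMap {h g : ℂ → ℂ} {U : Set ℂ} (hU : IsOpen U)
    (hh : DifferentiableOn ℂ h U) (hg : DifferentiableOn ℂ g U)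
    (hjac : ∀ z ∈ U, normSq (deriv g z) < normSq (deriv h z)) :
    IsOpen (harmonicMap h g '' U) := by
  rw [isOpen_iff_mem_nhds]
  rintro _ ⟨z, hz, rfl⟩
  have hs := (hh.hasStrictDerivAt hU hz).harmonicMap (hg.hasStrictDerivAt hU hz)
  rw [← coe_harmonicDifferentialEquiv _ _ (hjac z hz)] at hs
  rw [← hs.map_nhds_eq_of_equiv]
  exact Filter.image_mem_map (hU.mem_nhds hz)

/-! ### Level curves and univalence on a strip -/

theorem normSq_one_sub_half_lt {d : ℂ} (hd : 0 < d.re) :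
    normSq ((1 - d) / 2) < normSq ((1 + d) / 2) := by
  rw [← sub_pos]
  have : normSq ((1 + d) / 2) - normSq ((1 - d) / 2) = d.re := by
    simp [normSq_apply]; ring
  rwa [this]

/-- If `Re Φ' > 0`, the level set of `Im Φ` through a point is near this point a smooth curve
parametrized by the abscissa. -/
theorem exists_levelSet_parametrization {Φ : ℂ → ℂ} {d z₀ : ℂ} (hΦ : HasStrictDerivAt Φ d z₀)
    (hd : 0 < d.re) :
    ∃ (q : ℝ → ℂ) (v : ℂ), q z₀.re = z₀ ∧ HasDerivAt q v z₀.re ∧ v.re = 1 ∧ (v * d).im = 0 ∧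
      ∀ᶠ t in 𝓝 z₀.re, (q t).re = t ∧ (Φ (q t)).im = (Φ z₀).im := by
  -- `P z = Re z + i Im Φ(z)` straightens level sets to horizontal lines. Its Jacobian is `d.re`, so
  -- the inverse function theorem applies.
  set P : ℂ → ℂ := harmonicMap (fun z => (z + Φ z) / 2) (fun z => (z - Φ z) / 2) with hP
  have hPre : ∀ z, (P z).re = z.re := fun z => by
    simp [hP, harmonicMap, -map_sub, -map_div₀, -map_mul, -map_add]; ring
  have hPim : ∀ z, (P z).im = (Φ z).im := fun z => by
    simp [hP, harmonicMap, -map_sub, -map_div₀, -map_mul, -map_add]; ring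
  have hs : HasStrictFDerivAt P (harmonicDifferential ((1 + d) / 2) ((1 - d) / 2)) z₀ :=
    HasStrictDerivAt.harmonicMap (((hasStrictDerivAt_id z₀).add hΦ).div_const 2)
      (((hasStrictDerivAt_id z₀).sub hΦ).div_const 2)
  rw [← coe_harmonicDifferentialEquiv _ _ (normSq_one_sub_half_lt hd)] at hs
  set e := harmonicDifferentialEquiv _ _ (normSq_one_sub_half_lt hd) with he
  set Q := hs.localInverse P e z₀ with hQ
  have hQd : HasFDerivAt Q (e.symm : ℂ →L[ℝ] ℂ) (P z₀) := hs.to_localInverse.hasFDerivAt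
  have hline : HasDerivAt (fun t : ℝ => (t : ℂ) + (Φ z₀).im * I) 1 z₀.re :=
    (hasDerivAt_id z₀.re).ofReal_comp.add_const _
  have hPz : (z₀.re : ℂ) + (Φ z₀).im * I = P z₀ := by
    apply Complex.ext <;> simp [hPre, hPim]
  have hright : ∀ᶠ w in 𝓝 (P z₀), P (Q w) = w := hs.eventually_right_inverse
  have hev : e (e.symm 1) = 1 := e.apply_symm_apply 1
  have hecoe : ∀ v, e v = v * ((1 + d) / 2) + conj (v * ((1 - d) / 2)) := fun v => by
    rw [← harmonicDifferential_apply, ← coe_harmonicDifferentialEquiv _ _ (normSq_one_sub_half_lt hd)]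
    rfl
  rw [hecoe] at hev
  refine ⟨fun t => Q (t + (Φ z₀).im * I), e.symm 1, ?_, ?_, ?_, ?_, ?_⟩
  · simp only [hPz]
    exact hs.localInverse_apply_image
  · rw [← hPz] at hQd
    exact hQd.comp_hasDerivAt z₀.re hline
  · have := congrArg re hev
    simp [-map_sub, -map_div₀, -map_mul, -map_add] at this
    linarith
  · have := congrArg im hev
    simp [-map_sub, -map_div₀, -map_mul, -map_add] at this
    simp only [mul_im]
    linarith
  · have hc := hline.continuousAt.tendsto
    rw [hPz] at hc
    filter_upwards [hc.eventually hright] with t ht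
    have h1 := congrArg re ht
    have h2 := congrArg im ht
    rw [hPre] at h1
    rw [hPim] at h2
    simp at h1 h2
    exact ⟨h1, h2⟩

/-- Here `v` is tangent to a level curve of `Im Φ`, with `Φ' = a - b`. Tangency makes the real part
of the image velocity equal to the Jacobian divided by `Re (a - b)`. -/
theorem re_add_conj_pos {a b v : ℂ} (hab : normSq b < normSq a) (hd : 0 < (a - b).re)
    (hv : v.re = 1) (hvd : (v * (a - b)).im = 0) : 0 < (v * a + conj (v * b)).re := by
  simp only [normSq_apply] at hab
  simp only [mul_im, sub_im, sub_re, hv, one_mul, add_re, conj_re, mul_re] at *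
  have key : (a.re - b.re) * ((a.re - v.im * a.im) + (b.re - v.im * b.im))
      = a.re * a.re + a.im * a.im - (b.re * b.re + b.im * b.im) := by
    linear_combination (-(a.im + b.im)) * hvd
  by_contra hle
  push Not at hle
  nlinarith

/-- The vertical strip over `J`, as a subset of the complex plane, is open. -/
theorem isOpen_re_preimage {J : Set ℝ} (hJ : IsOpen J) : IsOpen (re ⁻¹' J) :=
  hJ.preimage continuous_re

/-- A sense-preserving harmonic mapping `H + conj G` of a vertical strip with
`Re (H' - G') > 0` is univalent, and its image meets horizontal lines in connected sets. -/
theorem injOn_and_isPreconnected_of_strip {H G : ℂ → ℂ} {J : Set ℝ} (hJo : IsOpen J)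
    (hJ : J.OrdConnected) (hH : DifferentiableOn ℂ H (re ⁻¹' J))
    (hG : DifferentiableOn ℂ G (re ⁻¹' J))
    (hjac : ∀ z ∈ re ⁻¹' J, normSq (deriv G z) < normSq (deriv H z))
    (hpos : ∀ z ∈ re ⁻¹' J, 0 < (deriv H z - deriv G z).re) :
    InjOn (harmonicMap H G) (re ⁻¹' J) ∧
      ∀ c : ℝ, IsPreconnected (harmonicMap H G '' (re ⁻¹' J) ∩ {w | w.im = c}) := by
  set S : Set ℂ := re ⁻¹' J with hS
  have hSo : IsOpen S := isOpen_re_preimage hJo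
  set Φ : ℂ → ℂ := fun z => H z - G z with hΦdef
  have hΦ : ∀ z ∈ S, HasStrictDerivAt Φ (deriv H z - deriv G z) z := fun z hz =>
    (hH.hasStrictDerivAt hSo hz).sub (hG.hasStrictDerivAt hSo hz)
  have hFim : ∀ z, (harmonicMap H G z).im = (Φ z).im := fun z => by
    simp [harmonicMap, hΦdef, sub_eq_add_neg]
  have hinj : ∀ x ∈ J, StrictMono fun y : ℝ => (Φ ⟨x, y⟩).im := fun x hx =>
    strictMono_im_vertical (fun y => (hΦ ⟨x, y⟩ hx).hasDerivAt.differentiableAt)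
      (fun y => by rw [(hΦ ⟨x, y⟩ hx).hasDerivAt.deriv]; exact hpos _ hx)
  have hU : ∀ c : ℝ, {x : ℝ | x ∈ J ∧ ∃ y : ℝ, (Φ ⟨x, y⟩).im = c}.OrdConnected :=
    ordConnected_levelSet_re hJ (fun z hz => (hΦ z hz).hasDerivAt.differentiableAt)
      (fun z hz => by rw [(hΦ z hz).hasDerivAt.deriv]; exact hpos z hz)
  have hcurve : ∀ c : ℝ, ∃ γ : ℝ → ℂ, ∃ U : Set ℝ, U.OrdConnected ∧
      (∀ x ∈ U, γ x ∈ S ∧ (γ x).re = x) ∧ (∀ z ∈ S, (Φ z).im = c → z.re ∈ U ∧ z = γ z.re) ∧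
      (∀ x ∈ U, (Φ (γ x)).im = c) ∧
      ∀ x ∈ U, ∃ v, HasDerivAt (fun t => harmonicMap H G (γ t)) v x ∧ 0 < v.re := by
    intro c
    classical
    have hch : ∀ x : ℝ, ∃ y : ℝ, (∃ y' : ℝ, (Φ ⟨x, y'⟩).im = c) → (Φ ⟨x, y⟩).im = c := by
      intro x
      by_cases h : ∃ y' : ℝ, (Φ ⟨x, y'⟩).im = c
      · exact ⟨h.choose, fun _ => h.choose_spec⟩
      · exact ⟨0, fun h' => absurd h' h⟩
    choose Y hY using hch
    have huniq : ∀ z ∈ S, (Φ z).im = c → z = ⟨z.re, Y z.re⟩ := by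
      rintro ⟨a, b⟩ hz h
      have h1 := hY a ⟨b, h⟩
      have h2 : b = Y a := (hinj a hz).injective (show (Φ ⟨a, b⟩).im = (Φ ⟨a, Y a⟩).im by rw [h1, h])
      simp only [← h2]
    refine ⟨fun x => ⟨x, Y x⟩, _, hU c, fun x hx => ⟨hx.1, rfl⟩,
      fun z hz h => ⟨⟨hz, z.im, h⟩, huniq z hz h⟩, fun x hx => hY x hx.2, ?_⟩
    rintro x ⟨hxJ, hxy⟩
    set z₀ : ℂ := ⟨x, Y x⟩ with hz₀
    have hz₀S : z₀ ∈ S := hxJ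
    obtain ⟨q, v, hq0, hqd, hv, hvd, hq⟩ :=
      exists_levelSet_parametrization (hΦ z₀ hz₀S) (hpos z₀ hz₀S)
    -- `Y` was merely chosen pointwise; uniqueness on verticals identifies it locally with the
    -- smooth parametrization, hence it is differentiable.
    have heq : (fun t => (⟨t, Y t⟩ : ℂ)) =ᶠ[𝓝 x] q := by
      have hSe : ∀ᶠ t in 𝓝 x, t ∈ J := hJo.mem_nhds hxJ
      filter_upwards [hq, hSe] with t ht htJ
      have h1 := huniq (q t) (show (q t).re ∈ J by rw [ht.1]; exact htJ)
        (by rw [ht.2]; exact hY x hxy)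
      rw [h1, ht.1]
    have hF := ((hH.hasStrictDerivAt hSo hz₀S).harmonicMap
      (hG.hasStrictDerivAt hSo hz₀S)).hasFDerivAt
    rw [← hq0] at hF
    have hd := hF.comp_hasDerivAt z₀.re hqd
    refine ⟨_, hd.congr_of_eventuallyEq (heq.fun_comp (harmonicMap H G)), ?_⟩
    rw [harmonicDifferential_apply, hq0]
    exact re_add_conj_pos (hjac z₀ hz₀S) (hpos z₀ hz₀S) hv hvd
  constructor
  · intro z hz z' hz' hzz
    obtain ⟨γ, U, hUc, -, hγ, -, hder⟩ := hcurve (Φ z).im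
    obtain ⟨h1, h2⟩ := hγ z hz rfl
    obtain ⟨h1', h2'⟩ := hγ z' hz' (by rw [← hFim, ← hFim, hzz])
    have hre : ∀ x ∈ U, ∃ r, HasDerivAt (fun t => (harmonicMap H G (γ t)).re) r x ∧ 0 < r := by
      intro x hx
      obtain ⟨v, hv, hv0⟩ := hder x hx
      exact ⟨v.re, by simpa [Function.comp_def] using (reCLM.hasFDerivAt).comp_hasDerivAt x hv, hv0⟩
    have hmono : StrictMonoOn (fun t => (harmonicMap H G (γ t)).re) U := by
      refine strictMonoOn_of_deriv_pos hUc.convex (fun x hx => ?_) (fun x hx => ?_)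
      · obtain ⟨r, hr, -⟩ := hre x hx
        exact hr.continuousAt.continuousWithinAt
      · obtain ⟨r, hr, hr0⟩ := hre x (interior_subset hx)
        rwa [hr.deriv]
    have : z.re = z'.re := hmono.injOn h1 h1' (by rw [← h2, ← h2', hzz])
    rw [h2, h2', this]
  · intro c
    obtain ⟨γ, U, hUc, hγS, hγ, hγc, hder⟩ := hcurve c
    have himg : harmonicMap H G '' S ∩ {w | w.im = c} = (fun t => harmonicMap H G (γ t)) '' U := by
      ext w
      constructor
      · rintro ⟨⟨z, hz, rfl⟩, hw⟩
        obtain ⟨h1, h2⟩ := hγ z hz (by rw [← hFim]; exact hw)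
        exact ⟨z.re, h1, by simp only; rw [← h2]⟩
      · rintro ⟨x, hx, rfl⟩
        exact ⟨⟨γ x, (hγS x hx).1, rfl⟩, by
          rw [mem_ofPred_eq, hFim]; exact hγc x hx⟩
    rw [himg]
    refine hUc.isPreconnected.image _ fun x hx => ?_
    obtain ⟨v, hv, -⟩ := hder x hx
    exact hv.continuousAt.continuousWithinAt

/-! ### The integral from zero and the kernel `psi` -/

theorem hasDerivAt_integralFromZero {F : ℂ → ℂ} (hF : DifferentiableOn ℂ F unitDisk) {z : ℂ}
    (hz : z ∈ unitDisk) : HasDerivAt (integralFromZero F) (F z) z := by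
  obtain ⟨Θ, hΘ⟩ := hF.isExactOn_ball
  have heq : ∀ w ∈ unitDisk, integralFromZero F w = Θ w - Θ 0 := by
    intro w hw
    have hmem : ∀ t ∈ uIcc (0 : ℝ) 1, (t : ℂ) * w ∈ unitDisk := by
      intro t ht
      rw [uIcc_of_le zero_le_one] at ht
      rw [mem_ball_zero_iff] at hw ⊢
      rw [norm_mul, norm_real, Real.norm_of_nonneg ht.1]
      exact (mul_le_of_le_one_left (norm_nonneg w) ht.2).trans_lt hw
    have hlin : ∀ t : ℝ, HasDerivAt (fun t : ℝ => (t : ℂ) * w) w t := fun t => by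
      simpa using (hasDerivAt_id t).ofReal_comp.mul_const w
    have hder : ∀ t ∈ uIcc (0 : ℝ) 1,
        HasDerivAt (fun t : ℝ => Θ (t * w)) (F (t * w) * w) t := fun t ht =>
      HasDerivAt.comp_of_eq t (hΘ _ (hmem t ht)) (hlin t) rfl
    have hcont : ContinuousOn (fun t : ℝ => F (t * w) * w) (uIcc (0 : ℝ) 1) :=
      (hF.continuousOn.comp (by fun_prop) hmem).mul continuousOn_const
    have := intervalIntegral.integral_eq_sub_of_hasDerivAt hder hcont.intervalIntegrable
    simpa [integralFromZero] using this
  have hnear : integralFromZero F =ᶠ[𝓝 z] fun w => Θ w - Θ 0 := by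
    filter_upwards [isOpen_ball.mem_nhds hz] with w hw using heq w hw
  exact ((hΘ z hz).sub_const _).congr_of_eventuallyEq hnear

theorem one_sub_two_mul_cos_add_sq (ν : ℝ) (w : ℂ) :
    1 - 2 * w * (Real.cos ν : ℂ) + w ^ 2 = (1 - w * exp (ν * I)) * (1 - w * exp (-(ν * I))) := by
  have h1 : exp (ν * I) * exp (-(ν * I)) = 1 := by rw [← exp_add]; simp
  have h2 : 2 * (Real.cos ν : ℂ) = exp (ν * I) + exp (-(ν * I)) := by
    rw [ofReal_cos, two_cos, neg_mul]
  linear_combination (-w) * h2 - w ^ 2 * h1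

theorem one_sub_two_mul_cos_add_sq_ne_zero (ν : ℝ) {w : ℂ} (hw : ‖w‖ < 1) :
    1 - 2 * w * (Real.cos ν : ℂ) + w ^ 2 ≠ 0 := by
  rw [one_sub_two_mul_cos_add_sq]
  have key : ∀ e : ℂ, ‖e‖ = 1 → 1 - w * e ≠ 0 := by
    intro e he h
    have : ‖w * e‖ = 1 := by rw [← sub_eq_zero.1 h, norm_one]
    rw [norm_mul, he, mul_one] at this
    exact hw.ne this
  refine mul_ne_zero (key _ (norm_exp_ofReal_mul_I ν)) (key _ ?_)
  have := norm_exp_ofReal_mul_I (-ν)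
  rwa [ofReal_neg, neg_mul] at this

theorem psi_eq_inv (μ ν : ℝ) (z : ℂ) :
    psi μ ν z = (1 - 2 * (z * exp (μ * I)) * (Real.cos ν : ℂ) + (z * exp (μ * I)) ^ 2)⁻¹ := by
  have : exp (2 * μ * I) = exp (μ * I) ^ 2 := by rw [← exp_nat_mul]; push_cast; ring_nf
  rw [psi, this]
  ring_nf

theorem differentiableOn_psi (μ ν : ℝ) : DifferentiableOn ℂ (psi μ ν) unitDisk := by
  rw [show psi μ ν = fun z => _ from funext (psi_eq_inv μ ν)]
  refine DifferentiableOn.inv (by fun_prop) fun z hz => ?_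
  refine one_sub_two_mul_cos_add_sq_ne_zero ν ?_
  rwa [norm_mul, norm_exp_ofReal_mul_I, mul_one, ← mem_ball_zero_iff]

/-! ### The strip or half-plane mapped onto the disk -/

theorem normSq_exp_sub_sub (ν : ℝ) (τ : ℂ) :
    normSq (1 - τ * exp (ν * I)) - normSq (exp (ν * I) - τ) = 4 * Real.sin ν * τ.im := by
  have h1 : (exp (ν * I)).re = Real.cos ν := exp_ofReal_mul_I_re ν
  have h2 : (exp (ν * I)).im = Real.sin ν := exp_ofReal_mul_I_im ν
  simp only [normSq_apply, sub_re, sub_im, mul_re, mul_im, one_re, one_im, h1, h2]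
  linear_combination (τ.re ^ 2 + τ.im ^ 2 - 1) * Real.sin_sq_add_cos_sq ν

/-- `T` maps the strip onto the upper half-plane, and `τ ↦ (e - τ) / (1 - τ e)` maps that onto the
disk by `normSq_exp_sub_sub`. -/
theorem exists_strip_map_of_sin_pos {ν : ℝ} (hs : 0 < Real.sin ν) :
    ∃ (J : Set ℝ) (w : ℂ → ℂ), IsOpen J ∧ J.OrdConnected ∧
      (∀ z ∈ re ⁻¹' J, HasDerivAt w (1 - 2 * w z * (Real.cos ν : ℂ) + w z ^ 2) z) ∧
      w '' (re ⁻¹' J) = unitDisk := by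
  set s := Real.sin ν with hsdef
  set e := exp (ν * I) with he
  set T : ℂ → ℂ := fun z => exp (I * (2 * s * z - ν)) with hT
  have heim : e.im = s := exp_ofReal_mul_I_im ν
  have hene : e ≠ 0 := exp_ne_zero _
  have hnorm : ‖e‖ = 1 := norm_exp_ofReal_mul_I ν
  have hinv : exp (-(ν * I)) = e⁻¹ := exp_neg _
  have hTim : ∀ z : ℂ, ν / (2 * s) < z.re → z.re < (ν + Real.pi) / (2 * s) → 0 < (T z).im := by
    intro z h1 h2
    rw [div_lt_iff₀ (by positivity)] at h1
    rw [lt_div_iff₀ (by positivity)] at h2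
    have : (I * (2 * s * z - ν)).im = 2 * s * z.re - ν := by simp
    simp only [hT]
    rw [exp_im, this]
    exact mul_pos (Real.exp_pos _) (Real.sin_pos_of_pos_of_lt_pi (by linarith) (by linarith))
  have hlt : ∀ τ : ℂ, 0 < τ.im → normSq (e - τ) < normSq (1 - τ * e) := by
    intro τ hτ
    rw [← sub_pos, normSq_exp_sub_sub]
    positivity
  have hne : ∀ τ : ℂ, 0 < τ.im → 1 - τ * e ≠ 0 := fun τ hτ h => by
    have := hlt τ hτ
    rw [h, map_zero] at this
    exact absurd this (not_lt.2 (normSq_nonneg _))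
  refine ⟨Ioo (ν / (2 * s)) ((ν + Real.pi) / (2 * s)), fun z => (e - T z) / (1 - T z * e),
    isOpen_Ioo, ordConnected_Ioo, ?_, ?_⟩
  · intro z hz
    have hn := hne _ (hTim z hz.1 hz.2)
    have hTd : HasDerivAt T (T z * (I * (2 * s))) z := by
      have : HasDerivAt (fun z : ℂ => I * (2 * s * z - ν)) (I * (2 * s)) z := by
        simpa using (((hasDerivAt_id z).const_mul (2 * (s : ℂ))).sub_const (ν : ℂ)).const_mul I
      exact this.cexp
    have hd := (hTd.const_sub e).div ((hTd.mul_const e).const_sub 1) hn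
    refine hd.congr_deriv ?_
    rw [one_sub_two_mul_cos_add_sq, hinv, ← he]
    have h2s : I * (2 * s) = e - e⁻¹ := by
      rw [← hinv, he, hsdef, ofReal_sin, two_sin, neg_mul]
      linear_combination (exp (-(ν * I)) - exp (ν * I)) * I_sq
    rw [h2s]
    field_simp
    ring
  · apply Subset.antisymm
    · rintro _ ⟨z, hz, rfl⟩
      have hτ := hTim z hz.1 hz.2
      have hn := hne _ hτ
      have h := hlt _ hτ
      rw [normSq_eq_norm_sq, normSq_eq_norm_sq] at h
      rw [mem_ball_zero_iff, norm_div, div_lt_one (norm_pos_iff.2 hn)]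
      exact lt_of_pow_lt_pow_left₀ 2 (norm_nonneg _) h
    · intro w hw
      rw [mem_ball_zero_iff] at hw
      have hwe : 1 - w * e ≠ 0 := fun h => by
        have : ‖w * e‖ = 1 := by rw [← sub_eq_zero.1 h, norm_one]
        rw [norm_mul, hnorm, mul_one] at this
        exact hw.ne this
      have he2 : 1 - e * e ≠ 0 := fun h => by
        have h2 : e = e⁻¹ := by field_simp; linear_combination -h
        have h3 := congrArg im h2
        rw [inv_im, normSq_eq_norm_sq, hnorm, heim] at h3
        linarith
      have hew : 1 - e * w ≠ 0 := by rwa [mul_comm e w]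
      -- The Möbius map is an involution, so the same formula gives the preimage.
      set τ := (e - w) / (1 - w * e) with hτdef
      have h1 : 1 - τ * e = (1 - e * e) / (1 - w * e) := by rw [hτdef]; field_simp; ring
      have h1n : 1 - τ * e ≠ 0 := by rw [h1]; exact div_ne_zero he2 hwe
      have h2 : e - τ = w * (1 - τ * e) := by rw [hτdef]; field_simp; ring
      have hτim : 0 < τ.im := by
        have h3 := normSq_exp_sub_sub ν τ
        rw [← he, h2, normSq_mul, normSq_eq_norm_sq w] at h3
        have h4 : 0 < normSq (1 - τ * e) := normSq_pos.2 h1n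
        have h5 : ‖w‖ ^ 2 < 1 := by nlinarith [norm_nonneg w]
        have h6 : 0 < 4 * s * τ.im := by rw [← hsdef] at h3; rw [← h3]; nlinarith
        exact pos_of_mul_pos_right h6 (by positivity)
      have hτ0 : τ ≠ 0 := fun h => by rw [h] at hτim; simp at hτim
      have hs0 : (s : ℂ) ≠ 0 := ofReal_ne_zero.2 hs.ne'
      have harg0 : 0 < arg τ :=
        lt_of_le_of_ne (arg_nonneg_iff.2 hτim.le) fun h => hτim.ne' (arg_eq_zero_iff.1 h.symm).2
      have hargpi : arg τ < Real.pi := arg_lt_pi_iff.2 (Or.inr hτim.ne')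
      refine ⟨(ν - I * log τ) / ((2 * s : ℝ) : ℂ), ?_, ?_⟩
      · have : ((ν - I * log τ) / ((2 * s : ℝ) : ℂ)).re = (ν + arg τ) / (2 * s) := by
          rw [div_ofReal_re]; simp [log_im]
        rw [mem_preimage, this]
        constructor
        · gcongr; linarith
        · gcongr
      · have hTτ : T ((ν - I * log τ) / ((2 * s : ℝ) : ℂ)) = τ := by
          have : I * (2 * s * ((ν - I * log τ) / ((2 * s : ℝ) : ℂ)) - ν) = log τ := by
            push_cast
            field_simp
            linear_combination (-log τ) * I_sq
          simp only [hT]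
          rw [this, exp_log hτ0]
        simp only [hTτ]
        rw [h2, mul_div_cancel_right₀ _ h1n]

/-- In this degenerate case `cos ν = ±1`, the equation becomes `w' = (1 - c w)²`, and its solution
`c - 1/z` maps a half-plane onto the disk. -/
theorem exists_strip_map_of_sin_eq_zero {ν : ℝ} (hs : Real.sin ν = 0) :
    ∃ (J : Set ℝ) (w : ℂ → ℂ), IsOpen J ∧ J.OrdConnected ∧
      (∀ z ∈ re ⁻¹' J, HasDerivAt w (1 - 2 * w z * (Real.cos ν : ℂ) + w z ^ 2) z) ∧
      w '' (re ⁻¹' J) = unitDisk := by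
  set c := Real.cos ν with hc
  have hcc : c * c = 1 := by have := Real.sin_sq_add_cos_sq ν; rw [hs] at this; linarith
  have hccC : (c : ℂ) * c = 1 := by rw [← ofReal_mul, hcc, ofReal_one]
  have hiff : ∀ z : ℂ, normSq (c * z - 1) < normSq z ↔ 1 / 2 < c * z.re := by
    intro z
    have : normSq (c * z - 1) = normSq z + 1 - 2 * (c * z.re) := by
      simp [normSq_apply]
      linear_combination (z.re ^ 2 + z.im ^ 2) * hcc
    rw [this]
    constructor <;> intro h <;> linarith
  have hne : ∀ z : ℂ, 1 / 2 < c * z.re → z ≠ 0 := by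
    rintro z hz rfl
    norm_num at hz
  have hrepr : ∀ z : ℂ, z ≠ 0 → c - z⁻¹ = (c * z - 1) / z := fun z hz => by field_simp
  refine ⟨{x | 1 / 2 < c * x}, fun z => c - z⁻¹, isOpen_lt (by fun_prop) (by fun_prop), ?_, ?_, ?_⟩
  · refine (Convex.ordConnected ?_)
    exact (convex_Ioi (1 / 2 : ℝ)).is_linear_preimage (f := fun x => c * x)
      (IsLinearMap.isLinearMap_smul c)
  · intro z hz
    have hz0 := hne z hz
    refine ((hasDerivAt_inv hz0).const_sub (c : ℂ)).congr_deriv ?_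
    field_simp
    linear_combination z ^ 2 * hccC
  · apply Subset.antisymm
    · rintro _ ⟨z, hz, rfl⟩
      have hz0 := hne z hz
      have h := (hiff z).2 hz
      rw [normSq_eq_norm_sq, normSq_eq_norm_sq] at h
      simp only [hrepr z hz0]
      rw [mem_ball_zero_iff, norm_div, div_lt_one (norm_pos_iff.2 hz0)]
      exact lt_of_pow_lt_pow_left₀ 2 (norm_nonneg _) h
    · intro w hw
      rw [mem_ball_zero_iff] at hw
      have hcw : (c : ℂ) - w ≠ 0 := fun h => by
        rw [← sub_eq_zero.1 h, norm_real, Real.norm_eq_abs] at hw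
        have := abs_mul_abs_self c
        nlinarith [abs_nonneg c]
      refine ⟨((c : ℂ) - w)⁻¹, ?_, by simp⟩
      have h0 : ((c : ℂ) - w)⁻¹ ≠ 0 := inv_ne_zero hcw
      refine (hiff _).1 ?_
      have h1 : (c : ℂ) * (c - w)⁻¹ - 1 = w * (c - w)⁻¹ := by field_simp; ring
      rw [h1, normSq_mul, normSq_eq_norm_sq w]
      have h2 : 0 < normSq ((c : ℂ) - w)⁻¹ := normSq_pos.2 h0
      have h5 : ‖w‖ ^ 2 < 1 := by nlinarith [norm_nonneg w]
      nlinarith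

/-- The inverse of a primitive of `(1 - 2 w cos ν + w²)⁻¹` maps a vertical strip or a half-plane
onto the unit disk. -/
theorem exists_strip_map (ν : ℝ) :
    ∃ (J : Set ℝ) (w : ℂ → ℂ), IsOpen J ∧ J.OrdConnected ∧
      (∀ z ∈ re ⁻¹' J, HasDerivAt w (1 - 2 * w z * (Real.cos ν : ℂ) + w z ^ 2) z) ∧
      w '' (re ⁻¹' J) = unitDisk := by
  rcases lt_trichotomy (Real.sin ν) 0 with h | h | h
  · have h' : 0 < Real.sin (-ν) := by rw [Real.sin_neg]; linarith
    simpa only [Real.cos_neg] using exists_strip_map_of_sin_pos h'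
  · exact exists_strip_map_of_sin_eq_zero h
  · exact exists_strip_map_of_sin_pos h

/-! ### The shear theorem on the disk -/

theorem normSq_deriv_lt_of_sensePreservingOn {h g : ℂ → ℂ} {U : Set ℂ} (hU : IsOpen U)
    (hh : DifferentiableOn ℂ h U) (hg : DifferentiableOn ℂ g U)
    (hsp : SensePreservingOn (harmonicMap h g) U) {z : ℂ} (hz : z ∈ U) :
    normSq (deriv g z) < normSq (deriv h z) := by
  have := hsp z hz
  rw [((hh.hasStrictDerivAt hU hz).harmonicMap (hg.hasStrictDerivAt hU hz)).hasFDerivAt.fderiv,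
    det_harmonicDifferential] at this
  linarith

/-- The shear construction for `∫ ψ_{μ,ν} p`. -/
theorem univalentConvexInDirection_of_shear {μ ν : ℝ} {h g p : ℂ → ℂ}
    (hh : DifferentiableOn ℂ h unitDisk) (hg : DifferentiableOn ℂ g unitDisk)
    (hp_pos : ∀ z ∈ unitDisk, 0 < (p z).re)
    (hjac : ∀ z ∈ unitDisk, normSq (deriv g z) < normSq (deriv h z))
    (hder : ∀ z ∈ unitDisk, deriv h z - exp (-2 * μ * I) * deriv g z = psi μ ν z * p z) :
    UnivalentConvexInDirection (-μ) (harmonicMap h g) := by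
  obtain ⟨J, w, hJo, hJ, hw, himg⟩ := exists_strip_map ν
  set e := exp (μ * I) with he
  set e' := exp (-(μ * I)) with he'
  have hee : e * e' = 1 := by rw [he, he', ← exp_add]; simp
  have he2 : exp (-2 * μ * I) = e' * e' := by rw [he', ← exp_add]; ring_nf
  have hconj : conj e' = e := by
    rw [he', ← exp_conj]; simp [he]
  have hne : normSq e = 1 := by
    rw [normSq_eq_norm_sq, he, norm_exp_ofReal_mul_I, one_pow]
  have hne' : ‖e'‖ = 1 := by
    have := norm_exp_ofReal_mul_I (-μ)
    rwa [ofReal_neg, neg_mul] at this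
  have hne'2 : normSq e' = 1 := by rw [normSq_eq_norm_sq, hne', one_pow]
  have hwmem : ∀ ζ ∈ re ⁻¹' J, w ζ ∈ unitDisk := fun ζ hζ => himg ▸ mem_image_of_mem w hζ
  have hmem : ∀ ζ ∈ re ⁻¹' J, e' * w ζ ∈ unitDisk := fun ζ hζ => by
    rw [mem_ball_zero_iff, norm_mul, hne', one_mul, ← mem_ball_zero_iff]
    exact hwmem ζ hζ
  have hsurj : ∀ z ∈ unitDisk, ∃ ζ ∈ re ⁻¹' J, z = e' * w ζ := by
    intro z hz
    have : e * z ∈ w '' (re ⁻¹' J) := by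
      rw [himg, mem_ball_zero_iff, norm_mul, he, norm_exp_ofReal_mul_I, one_mul,
        ← mem_ball_zero_iff]
      exact hz
    obtain ⟨ζ, hζ, h⟩ := this
    exact ⟨ζ, hζ, by rw [h]; linear_combination (-z) * hee⟩
  set d : ℂ → ℂ := fun ζ => 1 - 2 * w ζ * (Real.cos ν : ℂ) + w ζ ^ 2 with hd
  have hd0 : ∀ ζ ∈ re ⁻¹' J, d ζ ≠ 0 := fun ζ hζ =>
    one_sub_two_mul_cos_add_sq_ne_zero ν (mem_ball_zero_iff.1 (hwmem ζ hζ))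
  have hcomp : ∀ (a : ℂ) {k : ℂ → ℂ}, DifferentiableOn ℂ k unitDisk → ∀ ζ ∈ re ⁻¹' J,
      HasDerivAt (fun ζ => a * k (e' * w ζ)) (a * (deriv k (e' * w ζ) * (e' * d ζ))) ζ := by
    intro a k hk ζ hζ
    have h1 := (hk.hasStrictDerivAt isOpen_ball (hmem ζ hζ)).hasDerivAt
    exact (HasDerivAt.comp (h := fun ζ => e' * w ζ) ζ h1 ((hw ζ hζ).const_mul e')).const_mul a
  -- Rotating the image by `e` puts the factor `conj e = e'` on the co-analytic part; this matches
  -- the factor `exp (-2 * μ * I)` in the shear equation and makes `H' - G'` exactly `p (e' * w ζ)`.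
  set H : ℂ → ℂ := fun ζ => e * h (e' * w ζ) with hH
  set G : ℂ → ℂ := fun ζ => e' * g (e' * w ζ) with hG
  have hF : ∀ ζ, harmonicMap H G ζ = e * harmonicMap h g (e' * w ζ) := fun ζ => by
    simp only [harmonicMap, hH, hG, map_mul, hconj]
    ring
  obtain ⟨hinj, hconn⟩ := injOn_and_isPreconnected_of_strip (H := H) (G := G) hJo hJ
    (fun ζ hζ => (hcomp e hh ζ hζ).differentiableAt.differentiableWithinAt)
    (fun ζ hζ => (hcomp e' hg ζ hζ).differentiableAt.differentiableWithinAt)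
    (fun ζ hζ => by
      rw [(hcomp e hh ζ hζ).deriv, (hcomp e' hg ζ hζ).deriv]
      simp only [normSq_mul, hne, hne'2, one_mul]
      exact mul_lt_mul_of_pos_right (hjac _ (hmem ζ hζ)) (normSq_pos.2 (hd0 ζ hζ)))
    (fun ζ hζ => by
      rw [(hcomp e hh ζ hζ).deriv, (hcomp e' hg ζ hζ).deriv]
      have h1 := hder _ (hmem ζ hζ)
      have h2 : psi μ ν (e' * w ζ) = (d ζ)⁻¹ := by
        have h3 : e' * w ζ * e = w ζ := by linear_combination w ζ * hee
        rw [psi_eq_inv, ← he, h3]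
      rw [he2, h2] at h1
      have h3 := mul_inv_cancel₀ (hd0 ζ hζ)
      have h4 : e * (deriv h (e' * w ζ) * (e' * d ζ)) - e' * (deriv g (e' * w ζ) * (e' * d ζ))
          = p (e' * w ζ) := by
        linear_combination d ζ * h1 + p (e' * w ζ) * h3 + deriv h (e' * w ζ) * d ζ * hee
      rw [h4]
      exact hp_pos _ (hmem ζ hζ))
  have hcontf : ContinuousOn (harmonicMap h g) unitDisk :=
    hh.continuousOn.add (continuous_conj.comp_continuousOn hg.continuousOn)
  refine ⟨?_, isOpen_image_harmonicMap isOpen_ball hh hg hjac,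
    ((convex_ball (0 : ℂ) 1).isConnected ⟨0, by simp⟩).image _ hcontf, ?_⟩
  · intro z hz z' hz' hzz
    obtain ⟨ζ, hζ, rfl⟩ := hsurj z hz
    obtain ⟨ζ', hζ', rfl⟩ := hsurj z' hz'
    rw [hinj hζ hζ' (by rw [hF, hF, hzz])]
  · intro v
    have hline : harmonicMap h g '' unitDisk ∩ lineInDirection (-μ) v
        = (fun u => e' * u) '' (harmonicMap H G '' (re ⁻¹' J) ∩ {u | u.im = (e * v).im}) := by
      have hee' : exp (((-μ : ℝ) : ℂ) * I) = e' := by rw [he', ofReal_neg, neg_mul]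
      ext u
      simp only [lineInDirection, hee']
      constructor
      · rintro ⟨⟨z, hz, rfl⟩, t, ht⟩
        obtain ⟨ζ, hζ, rfl⟩ := hsurj z hz
        refine ⟨_, ⟨⟨ζ, hζ, rfl⟩, ?_⟩, ?_⟩
        · rw [mem_ofPred_eq, hF, ht]
          have : e * (v + t * e') = e * v + t := by linear_combination t * hee
          rw [this]
          simp
        · simp only [hF]
          linear_combination harmonicMap h g (e' * w ζ) * hee
      · rintro ⟨_, ⟨⟨ζ, hζ, rfl⟩, him⟩, rfl⟩
        rw [mem_ofPred_eq, hF] at him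
        simp only [hF]
        refine ⟨⟨_, hmem ζ hζ, by linear_combination -harmonicMap h g (e' * w ζ) * hee⟩,
          (e * harmonicMap h g (e' * w ζ) - e * v).re, ?_⟩
        have h1 : (((e * harmonicMap h g (e' * w ζ) - e * v).re : ℝ) : ℂ)
            = e * harmonicMap h g (e' * w ζ) - e * v := by
          apply Complex.ext
          · simp
          · rw [ofReal_im, sub_im, him, sub_self]
        rw [h1]
        linear_combination v * hee
    rw [hline]
    exact (hconn _).image _ (by fun_prop)

/-! ### Positivity of the Jacobian of a combination -/

theorem normSq_lt_normSq_add_iff (u G : ℂ) :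
    normSq G < normSq (u + G) ↔ 0 < normSq u + 2 * (conj u * G).re := by
  have : normSq (u + G) - normSq G = normSq u + 2 * (conj u * G).re := by
    simp [normSq_apply]; ring
  rw [← this, sub_pos]

/-- For fixed `u` the condition is a real-affine inequality in `G`, hence stable under convex
combinations. -/
theorem jacobian_pos_convex_combination {u G₁ G₂ : ℂ} (h₁ : normSq G₁ < normSq (u + G₁))
    (h₂ : normSq G₂ < normSq (u + G₂)) {η : ℝ} (h0 : 0 ≤ η) (h1 : η ≤ 1) :
    normSq (η * G₁ + (1 - η) * G₂) < normSq (u + (η * G₁ + (1 - η) * G₂)) := by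
  rw [normSq_lt_normSq_add_iff] at *
  have : normSq u + 2 * (conj u * (η * G₁ + (1 - η) * G₂)).re
      = η * (normSq u + 2 * (conj u * G₁).re) + (1 - η) * (normSq u + 2 * (conj u * G₂).re) := by
    simp; ring
  rw [this]
  rcases h0.eq_or_lt with rfl | h
  · simpa using h₂
  · have := mul_pos h h₁
    have := mul_nonneg (sub_nonneg.2 h1) h₂.le
    linarith

/-- The combination is a perturbation of the second mapping: its Jacobian is `|H₂|² - |G₂|²` plus a
term linear in `η`, which is controlled by `‖u‖ * ‖G₁ - G₂‖`. -/
theorem jacobian_pos_complex_combination {u H₁ G₁ H₂ G₂ η : ℂ} {A₁ A₂ α₁ α₂ : ℝ}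
    (hH₁ : H₁ = u + G₁) (hH₂ : H₂ = u + G₂) (hH₂0 : H₂ ≠ 0)
    (hG₁ : ‖G₁‖ = A₁ * ‖H₁‖) (hG₂ : ‖G₂‖ = A₂ * ‖H₂‖) (hA₁0 : 0 ≤ A₁) (hA₂0 : 0 ≤ A₂)
    (hA₁ : A₁ < α₁) (hA₂ : A₂ < α₂) (hα₁ : α₁ ≤ 1) (hα₂ : α₂ ≤ 1)
    (hη : ‖η‖ ≤ (1 - α₁) * (1 - α₂) / (2 * (α₁ + α₂))) :
    normSq (η * G₁ + (1 - η) * G₂) < normSq (η * H₁ + (1 - η) * H₂) := by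
  have hη' : ‖η‖ * (2 * (A₁ + A₂)) < (1 - A₁) * (1 - A₂) := by
    rw [le_div_iff₀ (by linarith)] at hη
    have h1 : ‖η‖ * (2 * (A₁ + A₂)) ≤ ‖η‖ * (2 * (α₁ + α₂)) :=
      mul_le_mul_of_nonneg_left (by linarith) (norm_nonneg η)
    nlinarith
  have hcomb : η * H₁ + (1 - η) * H₂ = u + (η * G₁ + (1 - η) * G₂) := by
    rw [hH₁, hH₂]; ring
  rw [hcomb, normSq_lt_normSq_add_iff]
  have hsplit : normSq u + 2 * (conj u * (η * G₁ + (1 - η) * G₂)).re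
      = normSq H₂ - normSq G₂ + 2 * (conj u * (η * (G₁ - G₂))).re := by
    rw [hH₂]; simp [normSq_apply]; ring
  have hre : |(conj u * (η * (G₁ - G₂))).re| ≤ ‖η‖ * (‖u‖ * ‖G₁ - G₂‖) := by
    refine (abs_re_le_norm _).trans (le_of_eq ?_)
    rw [norm_mul, norm_mul, norm_conj]; ring
  -- Writing `u` as `H₂ - G₂` against `G₁` and as `H₁ - G₁` against `G₂` cancels the product `G₁
  -- G₂`.
  have hu : ‖u‖ * ‖G₁ - G₂‖ ≤ ‖H₁‖ * ‖H₂‖ * (A₁ + A₂) := by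
    have h1 : u * (G₁ - G₂) = H₂ * G₁ - H₁ * G₂ := by rw [hH₁, hH₂]; ring
    rw [← norm_mul, h1]
    refine (norm_sub_le _ _).trans (le_of_eq ?_)
    rw [norm_mul, norm_mul, hG₁, hG₂]; ring
  -- Both sides are compared with `‖u‖`, the common norm of `H₁ - G₁` and `H₂ - G₂`.
  have hx : ‖H₁‖ * (1 - A₁) ≤ ‖H₂‖ * (1 + A₂) := by
    have h1 : H₁ - G₁ = H₂ - G₂ := by rw [hH₁, hH₂]; ring
    have h2 := norm_sub_norm_le H₁ G₁
    have h3 := norm_sub_le H₂ G₂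
    rw [h1] at h2
    rw [hG₁] at h2
    rw [hG₂] at h3
    linarith
  have hx₂ : 0 < ‖H₂‖ := norm_pos_iff.2 hH₂0
  have hmain : 2 * ‖η‖ * (A₁ + A₂) * ‖H₁‖ < ‖H₂‖ * (1 - A₂ ^ 2) := by
    have hA : 0 < 1 - A₁ := by linarith
    have h1 : (2 * ‖η‖ * (A₁ + A₂)) * (‖H₁‖ * (1 - A₁))
        ≤ (2 * ‖η‖ * (A₁ + A₂)) * (‖H₂‖ * (1 + A₂)) :=
      mul_le_mul_of_nonneg_left hx (by positivity)
    have h2 : ‖η‖ * (2 * (A₁ + A₂)) * (‖H₂‖ * (1 + A₂))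
        < (1 - A₁) * (1 - A₂) * (‖H₂‖ * (1 + A₂)) :=
      mul_lt_mul_of_pos_right hη' (by positivity)
    refine lt_of_mul_lt_mul_left ?_ hA.le
    linarith
  have hN : normSq H₂ - normSq G₂ = ‖H₂‖ * (‖H₂‖ * (1 - A₂ ^ 2)) := by
    rw [normSq_eq_norm_sq, normSq_eq_norm_sq, hG₂]; ring
  have h5 : ‖η‖ * (‖u‖ * ‖G₁ - G₂‖) ≤ ‖η‖ * (‖H₁‖ * ‖H₂‖ * (A₁ + A₂)) :=
    mul_le_mul_of_nonneg_left hu (norm_nonneg η)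
  have h6 := mul_lt_mul_of_pos_left hmain hx₂
  rw [hsplit, hN]
  have h7 := (abs_le.1 hre).1
  linarith

/-! ### The shear equation for combinations and the two ranges of `η` -/

theorem deriv_sub_eq_of_eq_integralFromZero {κ : ℂ} {h g F : ℂ → ℂ}
    (hh : DifferentiableOn ℂ h unitDisk) (hg : DifferentiableOn ℂ g unitDisk)
    (hF : DifferentiableOn ℂ F unitDisk)
    (heq : ∀ z ∈ unitDisk, h z - κ * g z = integralFromZero F z) {z : ℂ} (hz : z ∈ unitDisk) :
    deriv h z - κ * deriv g z = F z := by
  have h1 := (hh.hasStrictDerivAt isOpen_ball hz).hasDerivAt.sub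
    ((hg.hasStrictDerivAt isOpen_ball hz).hasDerivAt.const_mul κ)
  refine h1.unique ((hasDerivAt_integralFromZero hF hz).congr_of_eventuallyEq ?_)
  filter_upwards [isOpen_ball.mem_nhds hz] with w hw using heq w hw

theorem mainTheorem5 (μ ν : ℝ) (h₁ g₁ h₂ g₂ p : ℂ → ℂ)
    (hh₁ : DifferentiableOn ℂ h₁ unitDisk) (hg₁ : DifferentiableOn ℂ g₁ unitDisk)
    (hh₂ : DifferentiableOn ℂ h₂ unitDisk) (hg₂ : DifferentiableOn ℂ g₂ unitDisk)
    (hp : DifferentiableOn ℂ p unitDisk) (hp_pos : ∀ z ∈ unitDisk, 0 < (p z).re)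
    (hlu₁ : LocallyUnivalentOn (harmonicMap h₁ g₁) unitDisk)
    (hsp₁ : SensePreservingOn (harmonicMap h₁ g₁) unitDisk)
    (hlu₂ : LocallyUnivalentOn (harmonicMap h₂ g₂) unitDisk)
    (hsp₂ : SensePreservingOn (harmonicMap h₂ g₂) unitDisk)
    (heq₁ : ∀ z ∈ unitDisk, h₁ z - exp (-2 * μ * I) * g₁ z =
      integralFromZero (fun ξ => psi μ ν ξ * p ξ) z)
    (heq₂ : ∀ z ∈ unitDisk, h₂ z - exp (-2 * μ * I) * g₂ z =
      integralFromZero (fun ξ => psi μ ν ξ * p ξ) z) :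
    (∀ η : ℝ, 0 ≤ η → η ≤ 1 →
      UnivalentConvexInDirection (-μ) (combination (η : ℂ) h₁ g₁ h₂ g₂)) ∧
    (∀ α₁ α₂ : ℝ, α₁ ≤ 1 → α₂ ≤ 1 →
      (∀ z ∈ unitDisk, ‖dilatation h₁ g₁ z‖ < α₁) →
      (∀ z ∈ unitDisk, ‖dilatation h₂ g₂ z‖ < α₂) →
      ∀ η : ℂ, ‖η‖ ≤ (1 - α₁) * (1 - α₂) / (2 * (α₁ + α₂)) →
        UnivalentConvexInDirection (-μ) (combination η h₁ g₁ h₂ g₂)) := by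

  have hF : DifferentiableOn ℂ (fun ξ => psi μ ν ξ * p ξ) unitDisk :=
    (differentiableOn_psi μ ν).mul hp
  set κ := exp (-2 * μ * I) with hκ
  have hκ1 : ‖κ‖ = 1 := by
    have := norm_exp_ofReal_mul_I (-2 * μ)
    push_cast at this
    rw [hκ, this]
  have hκn : normSq κ = 1 := by rw [normSq_eq_norm_sq, hκ1, one_pow]
  have hd₁ := fun z hz => deriv_sub_eq_of_eq_integralFromZero hh₁ hg₁ hF heq₁ (z := z) hz
  have hd₂ := fun z hz => deriv_sub_eq_of_eq_integralFromZero hh₂ hg₂ hF heq₂ (z := z) hz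
  have hj₁ := fun z hz =>
    normSq_deriv_lt_of_sensePreservingOn isOpen_ball hh₁ hg₁ hsp₁ (z := z) hz
  have hj₂ := fun z hz =>
    normSq_deriv_lt_of_sensePreservingOn isOpen_ball hh₂ hg₂ hsp₂ (z := z) hz
  have hderiv : ∀ (η : ℂ) {k₁ k₂ : ℂ → ℂ}, DifferentiableOn ℂ k₁ unitDisk →
      DifferentiableOn ℂ k₂ unitDisk → ∀ z ∈ unitDisk,
      HasDerivAt (fun z => η * k₁ z + (1 - η) * k₂ z)
        (η * deriv k₁ z + (1 - η) * deriv k₂ z) z := fun η k₁ k₂ hk₁ hk₂ z hz =>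
    ((hk₁.hasStrictDerivAt isOpen_ball hz).hasDerivAt.const_mul η).add
      ((hk₂.hasStrictDerivAt isOpen_ball hz).hasDerivAt.const_mul (1 - η))
  have hmain : ∀ η : ℂ, (∀ z ∈ unitDisk, normSq (η * deriv g₁ z + (1 - η) * deriv g₂ z)
      < normSq (η * deriv h₁ z + (1 - η) * deriv h₂ z)) →
      UnivalentConvexInDirection (-μ) (combination η h₁ g₁ h₂ g₂) := by
    intro η hη
    refine univalentConvexInDirection_of_shear (ν := ν) (p := p)
      (fun z hz => (hderiv η hh₁ hh₂ z hz).differentiableAt.differentiableWithinAt)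
      (fun z hz => (hderiv η hg₁ hg₂ z hz).differentiableAt.differentiableWithinAt) hp_pos
      (fun z hz => ?_) (fun z hz => ?_)
    · rw [(hderiv η hg₁ hg₂ z hz).deriv, (hderiv η hh₁ hh₂ z hz).deriv]
      exact hη z hz
    · rw [(hderiv η hg₁ hg₂ z hz).deriv, (hderiv η hh₁ hh₂ z hz).deriv]
      linear_combination η * hd₁ z hz + (1 - η) * hd₂ z hz
  have hκmul : ∀ w, normSq (κ * w) = normSq w := fun w => by rw [normSq_mul, hκn, one_mul]
  have hadd₁ : ∀ z ∈ unitDisk, deriv h₁ z = psi μ ν z * p z + κ * deriv g₁ z := fun z hz => by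
    linear_combination hd₁ z hz
  have hadd₂ : ∀ z ∈ unitDisk, deriv h₂ z = psi μ ν z * p z + κ * deriv g₂ z := fun z hz => by
    linear_combination hd₂ z hz
  -- Absorbing the unimodular `κ` into `g'` gives both mappings the form `h' = u + G` with the same
  -- `u`, as the Jacobian lemmas require.
  have hcombine : ∀ (η : ℂ) (z : ℂ), normSq (η * deriv g₁ z + (1 - η) * deriv g₂ z)
      = normSq (η * (κ * deriv g₁ z) + (1 - η) * (κ * deriv g₂ z)) := fun η z => by
    rw [← hκmul]; ring_nf
  refine ⟨fun η h0 h1 => hmain η fun z hz => ?_, fun α₁ α₂ hα₁ hα₂ hω₁ hω₂ η hη =>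
    hmain η fun z hz => ?_⟩
  · have k₁ := hj₁ z hz
    have k₂ := hj₂ z hz
    rw [← hκmul, hadd₁ z hz] at k₁
    rw [← hκmul, hadd₂ z hz] at k₂
    have := jacobian_pos_convex_combination k₁ k₂ h0 h1
    rw [hcombine, hadd₁ z hz, hadd₂ z hz]
    convert this using 2
    ring
  · have hn : ∀ {h g : ℂ → ℂ}, normSq (deriv g z) < normSq (deriv h z) → deriv h z ≠ 0 :=
      fun hlt => normSq_pos.1 ((normSq_nonneg _).trans_lt hlt)
    have hdil : ∀ {h g : ℂ → ℂ}, deriv h z ≠ 0 →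
        ‖κ * deriv g z‖ = ‖dilatation h g z‖ * ‖deriv h z‖ := by
      intro h g h0
      rw [← norm_mul, dilatation, div_mul_cancel₀ _ h0, norm_mul, hκ1, one_mul]
    have n₁ := hn (hj₁ z hz)
    have n₂ := hn (hj₂ z hz)
    rw [hcombine]
    exact jacobian_pos_complex_combination (hadd₁ z hz) (hadd₂ z hz) n₂ (hdil n₁) (hdil n₂)
      (norm_nonneg _) (norm_nonneg _) (hω₁ z hz) (hω₂ z hz) hα₁ hα₂ hη
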